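/- Conventions. A shift space is a closed shift-invariant subset of $\mathcal A^{\mathbb Z}$, $\mathcal A$ a finite discrete alphabet, with shift $\sigma$; it is an SFT if it is the set of all sequences avoiding some finite set of forbidden words, and it is irreducible if for any words $u,v$ of its language there is a non-empty word $w$ of its language such that $uwv$ is in its language. Irreducible SFTs are assumed non-empty. A sliding block code is a continuous shift-commuting map, and a factor map is a surjective one. A factor map is unramified if there is an integer $d\ge 1$ (its degree) such that all its fibers have exactly $d$ elements. $\mathrm{Aut}(Y)$ is the group of shift-commuting homeomorphisms of $Y$, and for an unramified factor map $\varpi:Y\to X$, $\mathrm{Aut}(Y/X,\varpi)=\{\varphi\in\mathrm{Aut}(Y):\varpi\circ\varphi=\varpi\}$. The map $\varpi$ is a Galois factor if it is unramified and $|\mathrm{Aut}(Y/X,\varpi)|=\deg\varpi$; then $\mathrm{Gal}(Y/X,\varpi):=\mathrm{Aut}(Y/X,\varpi)$. An unramified intermediate factor of $\varpi$ is a triple $(Z,\alpha,\beta)$ with $Z$ an irreducible SFT, $\alpha:Y\to Z$ an unramified factor map and $\beta:Z\to X$ a sliding block code with $\beta\circ\alpha=\varpi$. Two such triples $(Z_1,\alpha_1,\beta_1)$,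 $(Z_2,\alpha_2,\beta_2)$ are topologically conjugate if there is a shift-commuting homeomorphism $f:Z_1\to Z_2$ with $f\circ\alpha_1=\alpha_2$ and $\beta_1=\beta_2\circ f$. Let $\mathcal I(Y/X,\varpi)$ be the set of topological conjugacy classes of unramified intermediate factors, and $\mathcal S(G)$ the set of all subgroups of a group $G$. Theorem (fundamental theorem of Galois theory for shifts of finite type). Let $X,Y$ be irreducible SFTs, let $\varpi:Y\to X$ be a Galois factor, and let $G=\mathrm{Gal}(Y/X,\varpi)$. For every subgroup $H\le G$, the orbit space $Y/H$ with the induced shift is topologically conjugate to an irreducible SFT $Z$. Transporting the quotient map $Y\to Y/H$ and the map $Y/H\to X$ induced by $\varpi$ along such a conjugacy gives an unramified intermediate factor $(Z,\alpha,\beta)$ of $\varpi$, with $\alpha$ a Galois factor, whose class $\Psi(H)\in\mathcal I(Y/X,\varpi)$ does not depend on the choices. The maps $$\Phi:\mathcal I(Y/X,\varpi)\to\mathcal S(G),\quad [(Z,\alpha,\beta)]\mapsto \mathrm{Aut}(Y/Z,\alpha),\qquad \Psi:\mathcal S(G)\to\mathcal I(Y/X,\varpi),\quad H\mapsto\Psi(H),$$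 are well defined and mutually inverse bijections. -/

import Mathlib

universe u v w

namespace ShiftGalois

open SymbolicDynamics.FullShift

section Words

variable {A : Type u} [TopologicalSpace A]

/-- The word `u` occurs in the bi-infinite sequence `x` at position `i`,
that is, `x_{[i, i + |u| - 1]} = u`. -/
def OccursAt (u : List A) (x : ℤ → A) (i : ℤ) : Prop :=
  ∀ (k : ℕ) (hk : k < u.length), x (i + k) = u[k]

/-- The language `𝓑(S)`: all words (the empty one included) occurring in points of `S`. -/
def language (S : Subshift A ℤ) : Set (List A) :=
  {u | ∃ x ∈ S.carrier, ∃ i : ℤ, OccursAt u x i}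

/-- `S` is a shift of finite type: it consists of all sequences that avoid some finite set of
forbidden words. -/
def IsSFT (S : Subshift A ℤ) : Prop :=
  ∃ F : Set (List A), F.Finite ∧ S.carrier = {x | ∀ u ∈ F, ∀ i : ℤ, ¬ OccursAt u x i}

/-- Irreducibility: any two words `u`, `v` of the language can be joined by a non-empty word. -/
def IsIrreducible (S : Subshift A ℤ) : Prop :=
  ∀ u ∈ language S, ∀ v ∈ language S, ∃ w ∈ language S, w ≠ [] ∧ u ++ w ++ v ∈ language S

end Words

/-- A (non-empty) irreducible shift of finite type over a finite discrete alphabet. -/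
structure IrreducibleSFT where
  /-- the alphabet -/
  Alphabet : Type u
  [finite : Finite Alphabet]
  [topology : TopologicalSpace Alphabet]
  [discrete : DiscreteTopology Alphabet]
  /-- the underlying shift space -/
  shiftSpace : Subshift Alphabet ℤ
  nonempty : shiftSpace.carrier.Nonempty
  isSFT : IsSFT shiftSpace
  irreducible : IsIrreducible shiftSpace

attribute [instance] IrreducibleSFT.finite IrreducibleSFT.topology IrreducibleSFT.discrete

/-- The space of points of the shift space, with the topology induced by the product topology on
`ℤ → Alphabet`. -/
abbrev IrreducibleSFT.Point (X : IrreducibleSFT.{u}) : Type u := X.shiftSpace.carrier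

instance : CoeSort IrreducibleSFT.{u} (Type u) := ⟨IrreducibleSFT.Point⟩

/-- The shift map `σ_X`, `(σ_X x)_i = x_{i+1}`. -/
def IrreducibleSFT.σ (X : IrreducibleSFT.{u}) (x : X) : X :=
  ⟨shift 1 x.1, X.shiftSpace.mapsTo 1 x.2⟩

/-- Sliding block codes: continuous shift-commuting maps. -/
structure SlidingBlockCode (Y : IrreducibleSFT.{v}) (X : IrreducibleSFT.{u}) where
  /-- the underlying map -/
  toFun : Y → X
  continuous : Continuous toFun
  map_shift : ∀ y : Y, toFun (Y.σ y) = X.σ (toFun y)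

instance (Y : IrreducibleSFT.{v}) (X : IrreducibleSFT.{u}) :
    CoeFun (SlidingBlockCode Y X) (fun _ => Y → X) := ⟨SlidingBlockCode.toFun⟩

/-- The automorphism group `Aut(Y)` of all shift-commuting self-homeomorphisms of `Y`,
with composition as multiplication. -/
def IrreducibleSFT.Aut (Y : IrreducibleSFT.{v}) : Subgroup (Y ≃ₜ Y) where
  carrier := {φ | ∀ y : Y, φ (Y.σ y) = Y.σ (φ y)}
  one_mem' := fun _ => rfl
  mul_mem' := by
    intro φ ψ hφ hψ y
    change φ (ψ (Y.σ y)) = Y.σ (φ (ψ y))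
    rw [hψ, hφ]
  inv_mem' := by
    intro φ hφ y
    change φ.symm (Y.σ y) = Y.σ (φ.symm y)
    rw [Homeomorph.symm_apply_eq, hφ, Homeomorph.apply_symm_apply]

namespace SlidingBlockCode

variable {X : IrreducibleSFT.{u}} {Y : IrreducibleSFT.{v}}

/-- A factor map is a surjective sliding block code. -/
def IsFactorMap (f : SlidingBlockCode Y X) : Prop := Function.Surjective f

/-- All fibers of `f` are finite with exactly `d ≥ 1` elements. -/
def HasDegree (f : SlidingBlockCode Y X) (d : ℕ) : Prop :=
  1 ≤ d ∧ ∀ x : X, Nat.card {y : Y // f y = x} = d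

/-- Unramified factor maps: finite-to-one and constant-to-one factor maps. -/
def IsUnramified (f : SlidingBlockCode Y X) : Prop :=
  f.IsFactorMap ∧ ∃ d : ℕ, f.HasDegree d

/-- The relative automorphism group `Aut(Y/X, f) = {φ ∈ Aut(Y) | f ∘ φ = f}`. -/
def relAut (f : SlidingBlockCode Y X) : Subgroup Y.Aut where
  carrier := {φ | ∀ y : Y, f (φ.1 y) = f y}
  one_mem' := fun _ => rfl
  mul_mem' := by
    intro φ ψ hφ hψ y
    change f (φ.1 (ψ.1 y)) = f y
    rw [hφ, hψ]
  inv_mem' := by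
    intro φ hφ y
    change f (φ.1.symm y) = f y
    rw [← hφ (φ.1.symm y), Homeomorph.apply_symm_apply]

/-- Galois factors: unramified factor maps with `|Aut(Y/X, f)| = deg f`. -/
def IsGalois (f : SlidingBlockCode Y X) : Prop :=
  f.IsFactorMap ∧ ∃ d : ℕ, f.HasDegree d ∧ Nat.card f.relAut = d

/-- The Galois group `Gal(Y/X, f) = Aut(Y/X, f)` (the notation used for Galois factors). -/
abbrev Gal (f : SlidingBlockCode Y X) : Type v := f.relAut

end SlidingBlockCode

section Intermediate

variable {X : IrreducibleSFT.{u}} {Y : IrreducibleSFT.{v}}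

/-- An unramified intermediate factor `(Z, α, β)` of `ϖ : Y → X`: an irreducible SFT `Z`, an
unramified factor map `α : Y → Z` and a sliding block code `β : Z → X` with `β ∘ α = ϖ`. -/
structure IntermediateFactor (ϖ : SlidingBlockCode Y X) where
  /-- the intermediate irreducible SFT -/
  Z : IrreducibleSFT.{w}
  /-- the map from above -/
  α : SlidingBlockCode Y Z
  /-- the map to the base -/
  β : SlidingBlockCode Z X
  unramified : α.IsUnramified
  comp_eq : ∀ y : Y, β (α y) = ϖ y

namespace IntermediateFactor

variable {ϖ : SlidingBlockCode Y X}

/-- Topological conjugacy of intermediate factors: a topological conjugacy `f : Z₁ → Z₂` with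
`f ∘ α₁ = α₂` and `β₁ = β₂ ∘ f`. -/
def Conj (F₁ F₂ : IntermediateFactor.{u, v, w} ϖ) : Prop :=
  ∃ f : F₁.Z ≃ₜ F₂.Z, (∀ z : F₁.Z, f (F₁.Z.σ z) = F₂.Z.σ (f z)) ∧
    (∀ y : Y, f (F₁.α y) = F₂.α y) ∧ ∀ z : F₁.Z, F₁.β z = F₂.β (f z)

theorem Conj.refl (F : IntermediateFactor.{u, v, w} ϖ) : F.Conj F :=
  ⟨Homeomorph.refl _, fun _ => rfl, fun _ => rfl, fun _ => rfl⟩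

theorem Conj.symm {F₁ F₂ : IntermediateFactor.{u, v, w} ϖ} (h : F₁.Conj F₂) : F₂.Conj F₁ := by
  obtain ⟨f, h1, h2, h3⟩ := h
  refine ⟨f.symm, fun z => ?_, fun y => ?_, fun z => ?_⟩
  · rw [Homeomorph.symm_apply_eq, h1, Homeomorph.apply_symm_apply]
  · rw [Homeomorph.symm_apply_eq, h2]
  · rw [h3, Homeomorph.apply_symm_apply]

theorem Conj.trans {F₁ F₂ F₃ : IntermediateFactor.{u, v, w} ϖ} (h : F₁.Conj F₂)
    (h' : F₂.Conj F₃) : F₁.Conj F₃ := by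
  obtain ⟨f, h1, h2, h3⟩ := h
  obtain ⟨g, k1, k2, k3⟩ := h'
  refine ⟨f.trans g, fun z => ?_, fun y => ?_, fun z => ?_⟩
  · simp only [Homeomorph.trans_apply]; rw [h1, k1]
  · simp only [Homeomorph.trans_apply]; rw [h2, k2]
  · simp only [Homeomorph.trans_apply]; rw [h3, k3]

/-- The equivalence relation of topological conjugacy of intermediate factors. -/
instance setoid (ϖ : SlidingBlockCode Y X) : Setoid (IntermediateFactor.{u, v, w} ϖ) where
  r := Conj
  iseqv := ⟨Conj.refl, Conj.symm, Conj.trans⟩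

/-- The subgroup `H(Z, α, β) = Aut(Y/Z, α)`, as a subgroup of `Gal(Y/X, ϖ)`
(see `relAut_le` for the inclusion). -/
def H (F : IntermediateFactor.{u, v, w} ϖ) : Subgroup ϖ.Gal :=
  F.α.relAut.subgroupOf ϖ.relAut

theorem relAut_le (F : IntermediateFactor.{u, v, w} ϖ) : F.α.relAut ≤ ϖ.relAut := by
  intro φ hφ y
  rw [← F.comp_eq, ← F.comp_eq]
  exact congrArg F.β (hφ y)

theorem H_eq_of_conj {F₁ F₂ : IntermediateFactor.{u, v, w} ϖ} (h : F₁.Conj F₂) :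
    F₁.H = F₂.H := by
  have key : ∀ {F₁ F₂ : IntermediateFactor.{u, v, w} ϖ}, F₁.Conj F₂ → F₁.H ≤ F₂.H := by
    rintro F₁ F₂ ⟨f, _, h2, _⟩ φ hφ y
    rw [← h2, ← h2]
    exact congrArg f (hφ y)
  exact le_antisymm (key h) (key h.symm)

end IntermediateFactor

/-- The set `𝓘(Y/X, ϖ)` of topological conjugacy classes of unramified intermediate factors. -/
abbrev ConjClass (ϖ : SlidingBlockCode Y X) :=
  Quotient (IntermediateFactor.setoid.{u, v, w} ϖ)

/-- The map `Φ` from conjugacy classes of intermediate factors to subgroups of the Galois group,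
`[(Z, α, β)] ↦ H(Z, α, β)`. -/
def ConjClass.Φ {ϖ : SlidingBlockCode Y X} : ConjClass.{u, v, w} ϖ → Subgroup ϖ.Gal :=
  Quotient.lift IntermediateFactor.H fun _ _ h => IntermediateFactor.H_eq_of_conj h

end Intermediate

section Orbit

variable {X : IrreducibleSFT.{u}} {Y : IrreducibleSFT.{v}} {ϖ : SlidingBlockCode Y X}

/-- The relation `y ∼ y'` iff `y' = h(y)` for some `h ∈ H`. -/
def orbitSetoid (H : Subgroup ϖ.Gal) : Setoid Y where
  r := fun y y' => ∃ h ∈ H, y' = h.1.1 y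
  iseqv :=
    { refl := fun _ => ⟨1, H.one_mem, rfl⟩
      symm := by
        rintro y _ ⟨h, hh, rfl⟩
        exact ⟨h⁻¹, H.inv_mem hh, (h.1.1.symm_apply_apply y).symm⟩
      trans := by
        rintro y _ _ ⟨h, hh, rfl⟩ ⟨k, hk, rfl⟩
        exact ⟨k * h, H.mul_mem hk hh, rfl⟩ }

/-- The orbit space `Y/H` (with the quotient topology). -/
abbrev OrbitSpace (H : Subgroup ϖ.Gal) : Type v := Quotient (orbitSetoid H)

namespace OrbitSpace

/-- The quotient map `q_H : Y → Y/H`. -/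
def proj (H : Subgroup ϖ.Gal) (y : Y) : OrbitSpace H := Quotient.mk (orbitSetoid H) y

/-- The shift map induced on `Y/H`, `[y] ↦ [σ_Y y]`. -/
def σ (H : Subgroup ϖ.Gal) : OrbitSpace H → OrbitSpace H :=
  Quotient.map Y.σ (by
    rintro y _ ⟨h, hh, rfl⟩
    exact ⟨h, hh, (h.1.2 y).symm⟩)

/-- The map `Y/H → X` induced by `ϖ`, `[y] ↦ ϖ y`. -/
def toBase (H : Subgroup ϖ.Gal) : OrbitSpace H → X :=
  Quotient.lift ϖ (by
    rintro y _ ⟨h, _, rfl⟩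
    exact (h.2 y).symm)

end OrbitSpace

/-- The intermediate factor `(Z, α, β)` is (topologically conjugate to) the orbit-space factor
`Y → Y/H → X`: there is a shift-commuting homeomorphism `Y/H ≃ Z` that carries the quotient map to
`α` and the induced map `Y/H → X` to `β`. -/
def IntermediateFactor.IsOrbitFactor (F : IntermediateFactor.{u, v, w} ϖ)
    (H : Subgroup ϖ.Gal) : Prop :=
  ∃ f : OrbitSpace H ≃ₜ F.Z, (∀ p : OrbitSpace H, f (OrbitSpace.σ H p) = F.Z.σ (f p)) ∧
    (∀ y : Y, f (OrbitSpace.proj H y) = F.α y) ∧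
    ∀ p : OrbitSpace H, OrbitSpace.toBase H p = F.β (f p)

end Orbit

end ShiftGalois

/-!
The proof rests on one dynamical fact: a constant-to-one code `ϖ : Y → X` between irreducible shifts
of finite type is uniformly injective along its fibres, i.e. there is a window `[-M, M]` on which
any two different points of a fibre differ (`SlidingBlockCode.HasDegree.exists_separated`). By the
Baire category theorem this holds over some open set; transitivity of `X` and the possibility of
splicing points of a shift of finite type spread it to all of `X`.

Hence the set on which two relative automorphisms agree is clopen and shift-invariant, so it is
empty or everything: `G = Aut(Y/X, ϖ)` acts freely (`HasDegree.relAut_ext`). When `|G| = deg ϖ` the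
fibres of `ϖ` are exactly the `G`-orbits (`IsGalois.exists_eq`).

For an intermediate factor `(Z, α, β)` the fibre of `α` through `y` is the set of all `g y` with `g`
in some `S y ⊆ G`. All the sets `S y` have `deg α` elements and the condition `T ⊆ S y` is closed in
`y`, so `S` is locally constant and shift-invariant, hence constant, with value `Aut(Y/Z, α)`. Thus
`Z` is the orbit space of `Aut(Y/Z, α)` (`IntermediateFactor.isOrbitFactor_H`).

Conversely, for `H ≤ G` a point `y` is coded by the sequence of `H`-classes of the central windows
of all the `g σⁱ y`, `g ∈ G`. Freeness and separation make the fibres of this code the `H`-orbits,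
and since sequences with allowed transitions lift to pseudo-orbits, which are shadowed in `Y`, the
image is of finite type (`SlidingBlockCode.IsGalois.exists_orbit_code`).
-/

namespace ShiftGalois

open SymbolicDynamics.FullShift

/-! ### Words and windows -/

section Windows

variable {A : Type u}

/-- Two sequences agree on the central window `[-n, n]`. -/
def Agree (n : ℕ) (x y : ℤ → A) : Prop := ∀ j : ℤ, -n ≤ j → j ≤ n → x j = y j

theorem Agree.symm {n : ℕ} {x y : ℤ → A} (h : Agree n x y) : Agree n y x :=
  fun j h1 h2 => (h j h1 h2).symm

theorem Agree.trans {n : ℕ} {x y z : ℤ → A} (h : Agree n x y) (h' : Agree n y z) : Agree n x z :=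
  fun j h1 h2 => (h j h1 h2).trans (h' j h1 h2)

theorem Agree.mono {m n : ℕ} (hmn : m ≤ n) {x y : ℤ → A} (h : Agree n x y) : Agree m x y :=
  fun j h1 h2 => h j (by omega) (by omega)

/-- The word of length `n` read off `x` from position `i` on. -/
def wordAt (x : ℤ → A) (i : ℤ) (n : ℕ) : List A := List.ofFn fun k : Fin n => x (i + (k : ℕ))

theorem length_wordAt (x : ℤ → A) (i : ℤ) (n : ℕ) : (wordAt x i n).length = n := by
  simp [wordAt]

theorem occursAt_wordAt_iff {x y : ℤ → A} {i j : ℤ} {n : ℕ} :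
    OccursAt (wordAt x i n) y j ↔ ∀ k : ℕ, k < n → y (j + k) = x (i + k) := by
  constructor
  · intro h k hk
    have := h k (by rwa [length_wordAt])
    simpa [wordAt] using this
  · intro h k hk
    rw [length_wordAt] at hk
    simpa [wordAt] using h k hk

theorem occursAt_append_iff {a b : List A} {x : ℤ → A} {i : ℤ} :
    OccursAt (a ++ b) x i ↔ OccursAt a x i ∧ OccursAt b x (i + a.length) := by
  constructor
  · intro h
    refine ⟨fun k hk => ?_, fun k hk => ?_⟩
    · rw [h k (by simp; omega), List.getElem_append_left hk]
    · have := h (a.length + k) (by simp; omega)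
      rw [List.getElem_append_right (by omega)] at this
      simpa [add_assoc] using this
  · rintro ⟨h1, h2⟩ k hk
    by_cases hka : k < a.length
    · rw [h1 k hka, List.getElem_append_left hka]
    · have := h2 (k - a.length) (by simp at hk; omega)
      rw [List.getElem_append_right (by omega), ← this]
      congr 1
      omega

variable [TopologicalSpace A]

theorem isOpen_setOf_agree [DiscreteTopology A] (n : ℕ) (x : ℤ → A) :
    IsOpen {y : ℤ → A | Agree n x y} := by
  have : {y : ℤ → A | Agree n x y} = cylinder (Finset.Icc (-n : ℤ) n) x := by
    ext y
    simp only [Agree, Set.mem_ofPred_eq, mem_cylinder, Finset.mem_Icc, and_imp]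
    exact forall_congr' fun j => by simp only [eq_comm]
  rw [this]
  exact isOpen_cylinder _ _

/-- Irreducibility is topological transitivity: from any central window of `x` one can pass to any
central window of `y`, after an arbitrarily long time. -/
theorem isIrreducible_iff {S : Subshift A ℤ} :
    IsIrreducible S ↔ ∀ x ∈ S.carrier, ∀ y ∈ S.carrier, ∀ n m : ℕ,
      ∃ z ∈ S.carrier, ∃ i : ℕ, m ≤ i ∧ Agree n x z ∧ Agree n y (shift (i : ℤ) z) := by
  constructor
  · intro h x hx y hy n m
    -- The first word is prolonged by `m` letters to the right to force a gap of at least `m`.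
    obtain ⟨w, -, -, z, hz, p, hp⟩ := h (wordAt x (-n) (2 * n + 1 + m))
      ⟨x, hx, -n, occursAt_wordAt_iff.2 fun _ _ => rfl⟩ (wordAt y (-n) (2 * n + 1))
      ⟨y, hy, -n, occursAt_wordAt_iff.2 fun _ _ => rfl⟩
    rw [occursAt_append_iff, occursAt_append_iff] at hp
    obtain ⟨⟨h1, -⟩, h2⟩ := hp
    rw [occursAt_wordAt_iff] at h1 h2
    simp only [List.length_append, length_wordAt] at h2
    refine ⟨shift (p + n) z, S.mapsTo _ hz, 2 * n + 1 + m + w.length, by omega,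
      fun j hj hj' => ?_, fun j hj hj' => ?_⟩
    · have := h1 (j + n).toNat (by omega)
      rw [shift_apply]
      convert this.symm using 2 <;> omega
    · have := h2 (j + n).toNat (by omega)
      rw [shift_apply, shift_apply]
      convert this.symm using 2 <;> push_cast <;> omega
  · rintro h a ⟨x, hx, p, hp⟩ b ⟨y, hy, q, hq⟩
    obtain ⟨z, hz, i, hi, h1, h2⟩ := h _ (S.mapsTo p hx) _ (S.mapsTo q hy)
      (a.length + b.length) (a.length + 1)
    have ha : OccursAt a z 0 := fun k hk => by
      rw [← hp k hk]
      have := h1 k (by omega) (by omega)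
      rw [shift_apply] at this
      rw [this, zero_add]
    have hb : OccursAt b z i := fun k hk => by
      rw [← hq k hk]
      have := h2 k (by omega) (by omega)
      rw [shift_apply, shift_apply] at this
      rw [this]
    have hw : OccursAt (wordAt z a.length (i - a.length)) z a.length :=
      occursAt_wordAt_iff.2 fun _ _ => rfl
    refine ⟨wordAt z a.length (i - a.length), ⟨z, hz, _, hw⟩, fun h0 => ?_, z, hz, 0, ?_⟩
    · have := congrArg List.length h0
      rw [length_wordAt, List.length_nil] at this
      omega
    · rw [occursAt_append_iff, occursAt_append_iff]
      refine ⟨⟨ha, by simpa using hw⟩, ?_⟩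
      convert hb using 1
      simp only [List.length_append, length_wordAt]
      omega

/-- A shift space is of finite type iff membership is decided on windows of bounded size. -/
theorem isSFT_iff [Finite A] {S : Subshift A ℤ} :
    IsSFT S ↔ ∃ n : ℕ, ∀ x : ℤ → A,
      (∀ i : ℤ, ∃ y ∈ S.carrier, Agree n y (shift i x)) → x ∈ S.carrier := by
  constructor
  · rintro ⟨F, hF, hS⟩
    obtain ⟨n, hn⟩ := (hF.image List.length).bddAbove
    refine ⟨n, fun x hx => ?_⟩
    rw [hS]
    intro a ha i hai
    obtain ⟨y, hy, hyx⟩ := hx i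
    rw [hS] at hy
    refine hy a ha 0 fun k hk => ?_
    have := hn ⟨a, ha, rfl⟩
    rw [← hai k hk, zero_add, hyx k (by omega) (by omega), shift_apply]
  · rintro ⟨n, hn⟩
    refine ⟨{a | a.length = 2 * n + 1 ∧ a ∉ language S},
      (List.finite_length_eq A (2 * n + 1)).subset fun a ha => ha.1, ?_⟩
    refine Set.Subset.antisymm (fun x hx a ha i hai => ha.2 ⟨x, hx, i, hai⟩) fun x hx => ?_
    refine hn x fun i => ?_
    have hl : wordAt x (i - n) (2 * n + 1) ∈ language S := by
      by_contra hl
      exact hx _ ⟨length_wordAt _ _ _, hl⟩ (i - n) (occursAt_wordAt_iff.2 fun _ _ => rfl)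
    obtain ⟨y, hy, p, hp⟩ := hl
    rw [occursAt_wordAt_iff] at hp
    refine ⟨shift (p + n) y, S.mapsTo _ hy, fun j hj hj' => ?_⟩
    have := hp (j + n).toNat (by omega)
    rw [shift_apply, shift_apply]
    convert this using 2 <;> omega

end Windows

/-! ### Shift spaces as compact dynamical systems -/

namespace IrreducibleSFT

variable (X : IrreducibleSFT.{u}) {B : Type v}

instance : CompactSpace X := isCompact_iff_compactSpace.1 X.shiftSpace.isClosed.isCompact

/-- The `i`-th power of the shift map, `i ∈ ℤ`. -/
def iter (i : ℤ) (x : X) : X := ⟨shift i x.1, X.shiftSpace.mapsTo i x.2⟩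

variable {X}

theorem iter_val (i : ℤ) (x : X) (j : ℤ) : (X.iter i x).1 j = x.1 (i + j) := rfl

theorem iter_zero (x : X) : X.iter 0 x = x := Subtype.ext (shift_zero _)

theorem iter_iter (i j : ℤ) (x : X) : X.iter i (X.iter j x) = X.iter (i + j) x :=
  Subtype.ext <| funext fun k => by
    simp only [iter_val]; rw [add_left_comm, add_assoc]

theorem iter_one (x : X) : X.iter 1 x = X.σ x := rfl

theorem iter_injective (i : ℤ) : Function.Injective (X.iter i) := fun x y h => by
  have := congrArg (X.iter (-i)) h
  simpa only [iter_iter, neg_add_cancel, iter_zero] using this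

theorem continuous_iter (i : ℤ) : Continuous (X.iter i) :=
  ((continuous_shift i).comp continuous_subtype_val).subtype_mk _

/-- A map commuting with the shift commutes with all its powers. -/
theorem map_iter {X : IrreducibleSFT.{u}} {Y : IrreducibleSFT.{v}} {f : Y → X}
    (hf : ∀ y, f (Y.σ y) = X.σ (f y)) (i : ℤ) (y : Y) : f (Y.iter i y) = X.iter i (f y) := by
  have hn : ∀ (n : ℕ) (y : Y), f (Y.iter n y) = X.iter n (f y) := by
    intro n
    induction n with
    | zero => intro y; simp only [Nat.cast_zero, iter_zero]
    | succ n ih =>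
      intro y
      rw [Nat.cast_succ, ← iter_iter, ← iter_iter, iter_one, iter_one, ih, hf]
  obtain ⟨n, rfl | rfl⟩ := i.eq_nat_or_neg
  · exact hn n y
  · apply iter_injective (n : ℤ)
    rw [← hn, iter_iter, iter_iter, add_neg_cancel, iter_zero, iter_zero]

theorem eq_of_forall_iter {x y : X} (h : ∀ i, (X.iter i x).1 0 = (X.iter i y).1 0) : x = y :=
  Subtype.ext <| funext fun i => by simpa only [iter_val, add_zero] using h i

theorem isOpen_agree (n : ℕ) (x : X) : IsOpen {y : X | Agree n x.1 y.1} :=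
  (isOpen_setOf_agree n x.1).preimage continuous_subtype_val

/-- The central cylinders form a neighbourhood basis. -/
theorem exists_agree_subset {U : Set X} (hU : IsOpen U) {x : X} (hx : x ∈ U) :
    ∃ n : ℕ, ∀ y : X, Agree n x.1 y.1 → y ∈ U := by
  obtain ⟨V, hV, rfl⟩ := isOpen_induced_iff.1 hU
  obtain ⟨I, u, hu, hI⟩ := isOpen_pi_iff.1 hV x.1 hx
  refine ⟨I.sup Int.natAbs, fun y hy => hI fun i hi => ?_⟩
  have : i.natAbs ≤ I.sup Int.natAbs := Finset.le_sup (f := Int.natAbs) hi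
  rw [← hy i (by omega) (by omega)]
  exact (hu i hi).2

/-- A continuous map to a discrete space reads only a bounded window (Curtis–Hedlund–Lyndon). -/
theorem exists_window [TopologicalSpace B] [DiscreteTopology B] {c : X → B} (hc : Continuous c) :
    ∃ n : ℕ, ∀ x y : X, Agree n x.1 y.1 → c x = c y := by
  have h : ∀ x : X, ∃ n : ℕ, ∀ y : X, Agree n x.1 y.1 → c y = c x := fun x =>
    exists_agree_subset ((isOpen_discrete {c x}).preimage hc) rfl
  choose n hn using h
  obtain ⟨t, ht⟩ := CompactSpace.elim_nhds_subcover (fun x : X => {y : X | Agree (n x) x.1 y.1})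
    fun x => (isOpen_agree _ _).mem_nhds fun _ _ _ => rfl
  refine ⟨t.sup n, fun x y hxy => ?_⟩
  have hx : x ∈ ⋃ z ∈ t, {y : X | Agree (n z) z.1 y.1} := ht ▸ Set.mem_univ x
  simp only [Set.mem_iUnion, Set.mem_ofPred_eq] at hx
  obtain ⟨z, hz, hzx⟩ := hx
  rw [hn z x hzx, hn z y (hzx.trans (hxy.mono (Finset.le_sup hz)))]

theorem continuous_of_window [TopologicalSpace B] {c : X → B} (n : ℕ)
    (h : ∀ x y : X, Agree n x.1 y.1 → c x = c y) : Continuous c :=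
  continuous_def.2 fun U _ => isOpen_iff_mem_nhds.2 fun x hx =>
    Filter.mem_of_superset ((isOpen_agree n x).mem_nhds fun _ _ _ => rfl) fun y hy => by
      rw [Set.mem_preimage, ← h x y hy]; exact hx

/-- The window form of continuity for shift-commuting maps: coordinate `i` of `f y` reads only the
coordinates of `y` in `[i - r, i + r]`. -/
theorem exists_window_map {X : IrreducibleSFT.{u}} {Y : IrreducibleSFT.{v}} {f : Y → X}
    (hf : Continuous f) (hs : ∀ y, f (Y.σ y) = X.σ (f y)) :
    ∃ r : ℕ, ∀ n (y z : Y), Agree (n + r) y.1 z.1 → Agree n (f y).1 (f z).1 := by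
  obtain ⟨r, hr⟩ := exists_window (c := fun y => (f y).1 0)
    ((continuous_apply 0).comp (continuous_subtype_val.comp hf))
  refine ⟨r, fun n y z h j hj hj' => ?_⟩
  have := hr (Y.iter j y) (Y.iter j z) fun k hk hk' => h _ (by push_cast; omega) (by push_cast; omega)
  simpa only [map_iter hs, iter_val, add_zero] using this

/-- Topological transitivity in terms of open sets. -/
theorem exists_iter_mem {U V : Set X} (hU : IsOpen U) (hV : IsOpen V) (hU' : U.Nonempty)
    (hV' : V.Nonempty) (m : ℕ) : ∃ x ∈ U, ∃ i : ℕ, m ≤ i ∧ X.iter i x ∈ V := by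
  obtain ⟨x, hx⟩ := hU'
  obtain ⟨y, hy⟩ := hV'
  obtain ⟨n, hn⟩ := exists_agree_subset hU hx
  obtain ⟨k, hk⟩ := exists_agree_subset hV hy
  obtain ⟨z, hz, i, hi, h1, h2⟩ :=
    isIrreducible_iff.1 X.irreducible x.1 x.2 y.1 y.2 (max n k) m
  exact ⟨⟨z, hz⟩, hn _ (h1.mono (le_max_left _ _)), i, hi, hk _ (h2.mono (le_max_right _ _))⟩

/-- A non-empty clopen shift-invariant set is everything. -/
theorem eq_univ_of_isClopen {U : Set X} (hU : IsClopen U) (hne : U.Nonempty)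
    (hs : ∀ x ∈ U, ∀ i, X.iter i x ∈ U) : U = Set.univ := by
  by_contra h
  obtain ⟨x, hx, i, -, hi⟩ := exists_iter_mem hU.isOpen hU.compl.isOpen hne
    (Set.nonempty_compl.2 h) 0
  exact hi (hs x hx i)

end IrreducibleSFT

/-! ### Uniform separation of fibres -/

namespace SlidingBlockCode

open IrreducibleSFT

variable {X : IrreducibleSFT.{u}} {Y : IrreducibleSFT.{v}} {f : SlidingBlockCode Y X}

theorem HasDegree.ncard_fibre {d : ℕ} (hf : f.HasDegree d) (x : X) : {y | f y = x}.ncard = d :=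
  hf.2 x

theorem HasDegree.finite_fibre {d : ℕ} (hf : f.HasDegree d) (x : X) : {y | f y = x}.Finite :=
  Set.finite_of_ncard_pos (by rw [hf.ncard_fibre]; exact hf.1)

/-- The set of points of `X` whose fibre is separated by the window `[-n, n]`. -/
def separatedSet (f : SlidingBlockCode Y X) (n : ℕ) : Set X :=
  {x | ∀ y z : Y, f y = x → f z = x → Agree n y.1 z.1 → y = z}

/-- Since all fibres have `d` elements, the fibre of `x` is separated by `[-n, n]` iff there are
`d` different patterns on `[-n, n]` that occur in it, which is a closed condition on `x`. -/
theorem HasDegree.isClosed_separatedSet {d : ℕ} (hf : f.HasDegree d) (n : ℕ) :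
    IsClosed (f.separatedSet n) := by
  let P : Y → (Finset.Icc (-n : ℤ) n → Y.Alphabet) := fun y j => y.1 j
  have hP : ∀ y z : Y, P y = P z ↔ Agree n y.1 z.1 := fun y z =>
    ⟨fun h j h1 h2 => congrFun h ⟨j, Finset.mem_Icc.2 ⟨h1, h2⟩⟩,
      fun h => funext fun j => h j (Finset.mem_Icc.1 j.2).1 (Finset.mem_Icc.1 j.2).2⟩
  have hPc : Continuous P := continuous_of_window n fun y z h => (hP y z).2 h
  have key : f.separatedSet n = ⋃ T ∈ {T : Set (Finset.Icc (-n : ℤ) n → Y.Alphabet) | T.ncard = d},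
      ⋂ p ∈ T, f '' (P ⁻¹' {p}) := by
    ext x
    simp only [separatedSet, Set.mem_ofPred_eq, Set.mem_iUnion, Set.mem_iInter, Set.mem_image,
      Set.mem_preimage, Set.mem_singleton_iff, exists_prop]
    constructor
    · intro h
      refine ⟨P '' {y | f y = x}, ?_, ?_⟩
      · rw [Set.InjOn.ncard_image, hf.ncard_fibre]
        exact fun y hy z hz hyz => h y z hy hz ((hP y z).1 hyz)
      · rintro _ ⟨y, hy, rfl⟩
        exact ⟨y, rfl, hy⟩
    · rintro ⟨T, hT, h⟩ y z hy hz hyz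
      have hsub : T ⊆ P '' {y | f y = x} := fun p hp => by
        obtain ⟨y, h1, h2⟩ := h p hp
        exact ⟨y, h2, h1⟩
      have hle : d ≤ (P '' {y | f y = x}).ncard := hT ▸ Set.ncard_le_ncard hsub
      have hle' := Set.ncard_image_le (f := P) (hf.finite_fibre x)
      rw [hf.ncard_fibre] at hle'
      exact Set.injOn_of_ncard_image_eq ((le_antisymm hle' hle).trans (hf.ncard_fibre x).symm)
        (hf.finite_fibre x) hy hz ((hP y z).2 hyz)
  rw [key]
  refine (Set.toFinite _).isClosed_biUnion fun T _ => isClosed_biInter fun p _ => ?_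
  exact (((isClosed_discrete {p}).preimage hPc).isCompact.image f.continuous).isClosed

theorem HasDegree.iUnion_separatedSet {d : ℕ} (hf : f.HasDegree d) :
    ⋃ n, f.separatedSet n = Set.univ := by
  refine Set.eq_univ_of_forall fun x => Set.mem_iUnion.2 ?_
  have h : ∀ p : Y × Y, ∃ n : ℕ, Agree n p.1.1 p.2.1 → p.1 = p.2 := fun p => by
    by_contra! h
    refine (h 0).2 (Subtype.ext <| funext fun j => ?_)
    exact (h j.natAbs).1 j (by omega) (by omega)
  choose n hn using h
  obtain ⟨N, hN⟩ := (((hf.finite_fibre x).prod (hf.finite_fibre x)).image n).bddAbove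
  exact ⟨N, fun y z hy hz hyz => hn (y, z) (hyz.mono (hN ⟨(y, z), ⟨hy, hz⟩, rfl⟩))⟩

/-- Two points of a fibre that agree on a long central window can be spliced within the fibre. -/
theorem exists_splice (f : SlidingBlockCode Y X) : ∃ N : ℕ, ∀ y z : Y, f y = f z →
    Agree N y.1 z.1 → ∃ s : Y, f s = f y ∧ (∀ j ≤ 0, s.1 j = y.1 j) ∧ ∀ j > 0, s.1 j = z.1 j := by
  obtain ⟨R, hR⟩ := isSFT_iff.1 Y.isSFT
  obtain ⟨r, hr⟩ := exists_window_map f.continuous f.map_shift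
  refine ⟨max R r, fun y z hf h => ?_⟩
  let s : ℤ → Y.Alphabet := fun j => if j ≤ 0 then y.1 j else z.1 j
  have hsy : ∀ i : ℤ, i ≤ 0 → Agree (max R r) (shift i y.1) (shift i s) := by
    intro i hi j hj hj'
    simp only [shift_apply, s]
    split_ifs with hij
    · rfl
    · exact h _ (by omega) (by omega)
  have hsz : ∀ i : ℤ, 0 < i → Agree (max R r) (shift i z.1) (shift i s) := by
    intro i hi j hj hj'
    simp only [shift_apply, s]
    split_ifs with hij
    · exact (h _ (by omega) (by omega)).symm
    · rfl
  have hs : s ∈ Y.shiftSpace.carrier := hR s fun i => by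
    rcases le_or_gt i 0 with hi | hi
    · exact ⟨_, (Y.iter i y).2, (hsy i hi).mono (le_max_left _ _)⟩
    · exact ⟨_, (Y.iter i z).2, (hsz i hi).mono (le_max_left _ _)⟩
  refine ⟨⟨s, hs⟩, eq_of_forall_iter fun i => ?_, fun j hj => if_pos hj,
    fun j hj => if_neg (not_le.2 hj)⟩
  rw [← map_iter f.map_shift, ← map_iter f.map_shift]
  rcases le_or_gt i 0 with hi | hi
  · refine (hr 0 (Y.iter i y) (Y.iter i ⟨s, hs⟩) ((hsy i hi).mono ?_) 0 (by simp) (by simp)).symm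
    simp
  · rw [map_iter f.map_shift i y, hf, ← map_iter f.map_shift]
    refine (hr 0 (Y.iter i z) (Y.iter i ⟨s, hs⟩) ((hsz i hi).mono ?_) 0 (by simp) (by simp)).symm
    simp

/-- A constant-to-one code is uniformly injective on central windows along its fibres. By Baire
some window `[-N, N]` separates the fibres over an open set `W`. If `y ≠ z` in a fibre agree on a
long window, then, by transitivity, such `y, z` may be taken over a point that visits `W` both in
the past and in the future; a splice of `y` and `z` then coincides with both. -/
theorem HasDegree.exists_separated {d : ℕ} (hf : f.HasDegree d) :
    ∃ M : ℕ, ∀ y z : Y, f y = f z → Agree M y.1 z.1 → y = z := by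
  obtain ⟨M, hM⟩ := exists_splice f
  have : Nonempty X := X.nonempty.to_subtype
  obtain ⟨N, hN⟩ := nonempty_interior_of_iUnion_of_closed
    (fun n => hf.isClosed_separatedSet n) hf.iUnion_separatedSet
  set W := interior (f.separatedSet N) with hW
  suffices h : (f.separatedSet M)ᶜ = ∅ by
    rw [Set.compl_empty_iff] at h
    exact ⟨M, fun y z hyz => (h ▸ Set.mem_univ (f z) : f z ∈ f.separatedSet M) y z hyz rfl⟩
  by_contra hne
  have hV := (hf.isClosed_separatedSet M).isOpen_compl
  obtain ⟨x₁, hx₁, i, hi, hxi⟩ := exists_iter_mem hV isOpen_interior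
    (Set.nonempty_iff_ne_empty.2 hne) hN (N + 1)
  obtain ⟨x, hx, k, hk, hkV, hkW⟩ := exists_iter_mem isOpen_interior
    (hV.inter (isOpen_interior.preimage (continuous_iter i))) hN ⟨x₁, hx₁, hxi⟩ (N + 1)
  refine hkV fun y z hy hz hyz => ?_
  obtain ⟨s, hs, hsy, hsz⟩ := hM y z (hy.trans hz.symm) hyz
  -- `s` coincides with `y` around the past visit `-k` to `W` and with `z` around the future one `i`.
  have h1 : s = y := by
    apply iter_injective (-k : ℤ)
    refine interior_subset hx _ _ ?_ ?_ fun j hj hj' => ?_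
    · rw [map_iter f.map_shift, hs, hy, iter_iter, neg_add_cancel, iter_zero]
    · rw [map_iter f.map_shift, hy, iter_iter, neg_add_cancel, iter_zero]
    · exact hsy _ (by omega)
  have h2 : s = z := by
    apply iter_injective (i : ℤ)
    refine interior_subset hkW _ _ ?_ ?_ fun j hj hj' => ?_
    · rw [map_iter f.map_shift, hs, hy]
    · rw [map_iter f.map_shift, hz]
    · exact hsz _ (by omega)
  exact h1.symm.trans h2

end SlidingBlockCode

/-! ### The action of the Galois group on fibres -/

namespace SlidingBlockCode

open IrreducibleSFT

variable {X : IrreducibleSFT.{u}} {Y : IrreducibleSFT.{v}} {ϖ : SlidingBlockCode Y X}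

/-- Relative automorphisms of a constant-to-one code act freely: by uniform separation of fibres,
the set where two of them agree is not only closed but open. -/
theorem HasDegree.relAut_ext {d : ℕ} (hd : ϖ.HasDegree d) {g h : ϖ.Gal} {y : Y}
    (hy : g.1.1 y = h.1.1 y) : g = h := by
  obtain ⟨M, hM⟩ := hd.exists_separated
  obtain ⟨r, hr⟩ := exists_window_map g.1.1.continuous g.1.2
  obtain ⟨s, hs⟩ := exists_window_map h.1.1.continuous h.1.2
  have hU : {y | g.1.1 y = h.1.1 y} = Set.univ := by
    refine eq_univ_of_isClopen ⟨isClosed_eq g.1.1.continuous h.1.1.continuous, ?_⟩ ⟨y, hy⟩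
      fun z hz i => ?_
    · refine isOpen_iff_mem_nhds.2 fun z hz => Filter.mem_of_superset
        ((isOpen_agree (M + max r s) z).mem_nhds fun _ _ _ => rfl) fun x hx => ?_
      have h1 := hr M z x (hx.mono (by omega))
      have h2 := hs M z x (hx.mono (by omega))
      refine hM _ _ ((g.2 x).trans (h.2 x).symm) (h1.symm.trans ?_)
      rw [show g.1.1 z = h.1.1 z from hz]
      exact h2
    · change g.1.1 _ = h.1.1 _
      rw [map_iter g.1.2, map_iter h.1.2, show g.1.1 z = h.1.1 z from hz]
  exact Subtype.ext <| Subtype.ext <| Homeomorph.ext fun z => hU.ge (Set.mem_univ z)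

theorem IsGalois.finite (hϖ : ϖ.IsGalois) : Finite ϖ.Gal := by
  obtain ⟨-, d, hd, hc⟩ := hϖ
  exact Nat.finite_of_card_ne_zero (hc.trans_ne (Nat.one_le_iff_ne_zero.1 hd.1))

/-- The fibres of a Galois factor are the orbits of its Galois group. -/
theorem IsGalois.exists_eq (hϖ : ϖ.IsGalois) {y z : Y} (h : ϖ y = ϖ z) :
    ∃ g : ϖ.Gal, z = g.1.1 y := by
  obtain ⟨-, d, hd, hc⟩ := hϖ
  have hinj : Function.Injective fun g : ϖ.Gal => g.1.1 y := fun g k hgk => hd.relAut_ext hgk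
  have hsub : (Set.range fun g : ϖ.Gal => g.1.1 y) ⊆ {z | ϖ z = ϖ y} := by
    rintro _ ⟨g, rfl⟩
    exact g.2 y
  have heq := Set.eq_of_subset_of_ncard_le hsub (by
    rw [hd.ncard_fibre, ← Nat.card_coe_set_eq, Nat.card_range_of_injective hinj, hc])
    (hd.finite_fibre _)
  obtain ⟨g, hg⟩ : z ∈ Set.range fun g : ϖ.Gal => g.1.1 y := heq ▸ h.symm
  exact ⟨g, hg.symm⟩

theorem IsGalois.relAut_ext (hϖ : ϖ.IsGalois) {g h : ϖ.Gal} {y : Y}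
    (hy : g.1.1 y = h.1.1 y) : g = h :=
  hϖ.2.elim fun _ hd => hd.1.relAut_ext hy

/-- A factor map whose fibres are the orbits of a subgroup `H` of the Galois group has
degree `|H|`. -/
theorem IsGalois.hasDegree_of_orbits (hϖ : ϖ.IsGalois) {H : Subgroup ϖ.Gal}
    {Z : IrreducibleSFT.{w}} {α : SlidingBlockCode Y Z} (hα : α.IsFactorMap)
    (h : ∀ y z, α y = α z ↔ ∃ g ∈ H, z = g.1.1 y) : α.HasDegree (Nat.card H) := by
  have := hϖ.finite
  refine ⟨Nat.card_pos, fun x => ?_⟩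
  obtain ⟨y, rfl⟩ := hα x
  refine (Nat.card_congr (Equiv.ofBijective
    (fun g : H => (⟨g.1.1.1 y, ((h y _).2 ⟨g.1, g.2, rfl⟩).symm⟩ : {z // α z = α y})) ⟨?_, ?_⟩)).symm
  · intro g k hgk
    exact Subtype.ext (hϖ.relAut_ext (congrArg Subtype.val hgk))
  · rintro ⟨z, hz⟩
    obtain ⟨g, hg, rfl⟩ := (h y z).1 hz.symm
    exact ⟨⟨g, hg⟩, rfl⟩

end SlidingBlockCode

/-! ### Intermediate factors and subgroups -/

namespace IntermediateFactor

open IrreducibleSFT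

variable {X : IrreducibleSFT.{u}} {Y : IrreducibleSFT.{v}} {ϖ : SlidingBlockCode Y X}

/-- An intermediate factor `(Z, α, β)` is the orbit factor of `H` iff the fibres of `α` are the
`H`-orbits; compactness makes the induced bijection `Y/H → Z` a homeomorphism. -/
theorem isOrbitFactor_iff {F : IntermediateFactor.{u, v, w} ϖ} {H : Subgroup ϖ.Gal} :
    F.IsOrbitFactor H ↔ ∀ y z, F.α y = F.α z ↔ ∃ g ∈ H, z = g.1.1 y := by
  constructor
  · rintro ⟨f, -, h2, -⟩ y z
    rw [← h2, ← h2, f.injective.eq_iff]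
    exact Quotient.eq (r := orbitSetoid H)
  · intro h
    let q : OrbitSpace H → F.Z := Quotient.lift F.α fun y z hyz => (h y z).2 hyz
    have hq : Function.Bijective q := by
      refine ⟨?_, fun z => (F.unramified.1 z).imp' (OrbitSpace.proj H) fun y hy => hy⟩
      rintro ⟨y⟩ ⟨z⟩ hyz
      exact Quotient.sound ((h y z).1 hyz)
    have hc : Continuous q := F.α.continuous.quotient_lift _
    refine ⟨Continuous.homeoOfEquivCompactToT2 (f := Equiv.ofBijective q hq) hc, ?_,
      fun y => rfl, ?_⟩
    · rintro ⟨y⟩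
      exact F.α.map_shift y
    · rintro ⟨y⟩
      exact (F.comp_eq y).symm

theorem IsOrbitFactor.conj {F F' : IntermediateFactor.{u, v, w} ϖ} {H : Subgroup ϖ.Gal}
    (h : F.IsOrbitFactor H) (h' : F'.IsOrbitFactor H) : F.Conj F' := by
  obtain ⟨f, h1, h2, h3⟩ := h
  obtain ⟨k, k1, k2, k3⟩ := h'
  refine ⟨f.symm.trans k, fun z => ?_, fun y => ?_, fun z => ?_⟩
  · obtain ⟨p, rfl⟩ := f.surjective z
    rw [← h1]
    simp [k1]
  · rw [← h2]
    simp [k2]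
  · obtain ⟨p, rfl⟩ := f.surjective z
    rw [← h3]
    simp [k3]

theorem IsOrbitFactor.of_conj {F F' : IntermediateFactor.{u, v, w} ϖ} {H : Subgroup ϖ.Gal}
    (h : F.IsOrbitFactor H) (hc : F.Conj F') : F'.IsOrbitFactor H := by
  rw [isOrbitFactor_iff] at h ⊢
  obtain ⟨f, -, h2, -⟩ := hc
  intro y z
  rw [← h2, ← h2, f.injective.eq_iff]
  exact h y z

theorem IsOrbitFactor.H_eq (hϖ : ϖ.IsGalois) {F : IntermediateFactor.{u, v, w} ϖ}
    {H : Subgroup ϖ.Gal} (h : F.IsOrbitFactor H) : F.H = H := by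
  rw [isOrbitFactor_iff] at h
  ext g
  refine ⟨fun hg => ?_, fun hg y => ((h _ _).2 ⟨g, hg, rfl⟩).symm⟩
  obtain ⟨y, hy⟩ := Y.nonempty
  obtain ⟨k, hk, hgk⟩ := (h ⟨y, hy⟩ (g.1.1 ⟨y, hy⟩)).1 (hg ⟨y, hy⟩).symm
  rwa [hϖ.relAut_ext hgk]

theorem IsOrbitFactor.isGalois (hϖ : ϖ.IsGalois) {F : IntermediateFactor.{u, v, w} ϖ}
    {H : Subgroup ϖ.Gal} (h : F.IsOrbitFactor H) : F.α.IsGalois := by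
  refine ⟨F.unramified.1, Nat.card H,
    hϖ.hasDegree_of_orbits F.unramified.1 (isOrbitFactor_iff.1 h), ?_⟩
  rw [← h.H_eq hϖ]
  exact (Nat.card_congr (Subgroup.subgroupOfEquivOfLe F.relAut_le).toEquiv).symm

/-- Every unramified intermediate factor is the orbit factor of its group. For `y : Y` the set
`S y` of those `g ∈ G` that move `y` within its `α`-fibre has `deg α` elements, so it is locally
constant and hence constant; its elements are therefore automorphisms over `Z`. -/
theorem isOrbitFactor_H (hϖ : ϖ.IsGalois) (F : IntermediateFactor.{u, v, w} ϖ) :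
    F.IsOrbitFactor F.H := by
  have := hϖ.finite
  obtain ⟨-, e, he⟩ := F.unramified
  let S : Y → Set ϖ.Gal := fun y => {g | F.α (g.1.1 y) = F.α y}
  have hϖα : ∀ y z, F.α y = F.α z → ∃ g : ϖ.Gal, z = g.1.1 y := fun y z h =>
    hϖ.exists_eq (by rw [← F.comp_eq, ← F.comp_eq, h])
  have hcard : ∀ y, (S y).ncard = e := by
    intro y
    have himg : (fun g : ϖ.Gal => g.1.1 y) '' S y = {z | F.α z = F.α y} := by
      ext z
      constructor
      · rintro ⟨g, hg, rfl⟩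
        exact hg
      · intro hz
        obtain ⟨g, rfl⟩ := hϖα y z hz.symm
        exact ⟨g, hz, rfl⟩
    rw [← he.ncard_fibre (F.α y), ← himg,
      Set.ncard_image_of_injective _ fun g k hgk => hϖ.relAut_ext hgk]
  have heq : ∀ {T : Set ϖ.Gal} {y}, T.ncard = e → (T ⊆ S y ↔ S y = T) := fun {T y} hT =>
    ⟨fun h => (Set.eq_of_subset_of_ncard_le h (by rw [hT, hcard])).symm, fun h => h.ge⟩
  have hclosed : ∀ T : Set ϖ.Gal, T.ncard = e → IsClosed {y | S y = T} := by
    intro T hT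
    have : {y | S y = T} = ⋂ g ∈ T, {y | F.α (g.1.1 y) = F.α y} := by
      ext y
      simp only [Set.mem_ofPred_eq, Set.mem_iInter, ← heq hT]
      rfl
    rw [this]
    exact isClosed_biInter fun g _ =>
      isClosed_eq (F.α.continuous.comp g.1.1.continuous) F.α.continuous
  have hconst : ∀ y z, S z = S y := by
    intro y z
    have hcompl : {z | S z = S y}ᶜ =
        ⋃ T ∈ {T : Set ϖ.Gal | T.ncard = e ∧ T ≠ S y}, {z | S z = T} := by
      ext z
      simp [hcard]
    have hU : {z | S z = S y} = Set.univ := by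
      refine eq_univ_of_isClopen ⟨hclosed _ (hcard y), ?_⟩ ⟨y, rfl⟩ fun x hx i => ?_
      · rw [← isClosed_compl_iff, hcompl]
        exact (Set.toFinite _).isClosed_biUnion fun T hT => hclosed T hT.1
      · rw [Set.mem_ofPred_eq, ← heq (hcard y)]
        intro g hg
        have hg' : g ∈ S x := hx ▸ hg
        change F.α _ = F.α _
        rw [map_iter g.1.2, map_iter F.α.map_shift, map_iter F.α.map_shift,
          show F.α (g.1.1 x) = F.α x from hg']
    exact hU.ge (Set.mem_univ z)
  refine isOrbitFactor_iff.2 fun y z => ⟨fun h => ?_, ?_⟩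
  · obtain ⟨g, rfl⟩ := hϖα y z h
    exact ⟨g, fun x => (hconst y x ▸ h.symm : g ∈ S x), rfl⟩
  · rintro ⟨g, hg, rfl⟩
    exact (hg y).symm

end IntermediateFactor

/-! ### Shadowing -/

/-- Every sequence in a group is the sequence of right increments of some sequence over `ℤ`. -/
theorem exists_int_seq {G : Type*} [Group G] (k : ℤ → G) :
    ∃ h : ℤ → G, ∀ i, h (i + 1) = h i * k i := by
  let p : ℕ → G := fun n => Nat.rec 1 (fun n a => a * k n) n
  let q : ℕ → G := fun n => Nat.rec (k (-1))⁻¹ (fun n a => a * (k (-(n + 2 : ℕ)))⁻¹) n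
  refine ⟨fun i => Int.casesOn i p q, fun i => ?_⟩
  match i with
  | Int.ofNat n => rfl
  | Int.negSucc 0 => exact (inv_mul_cancel (k (-1))).symm
  | Int.negSucc (n + 1) => exact (inv_mul_cancel_right (q n) (k (-(n + 2 : ℕ)))).symm

namespace IrreducibleSFT

variable {Y : IrreducibleSFT.{v}}

/-- In a shift of finite type, pseudo-orbits for a sufficiently long window are shadowed. -/
theorem exists_shadow (Y : IrreducibleSFT.{v}) : ∃ N : ℕ, ∀ K ≥ N, ∀ p : ℤ → Y,
    (∀ i, Agree K (p (i + 1)).1 (Y.σ (p i)).1) → ∃ y : Y, ∀ i, Agree K (Y.iter i y).1 (p i).1 := by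
  obtain ⟨N, hN⟩ := isSFT_iff.1 Y.isSFT
  refine ⟨N, fun K hK p hp => ?_⟩
  -- Sliding a letter of `p i` to the left `m` steps along the pseudo-orbit, staying in the window.
  have hstep : ∀ m : ℕ, ∀ i l : ℤ, -K ≤ l → l + m ≤ K → (p i).1 (l + m) = (p (i + m)).1 l := by
    intro m
    induction m with
    | zero => intro i l _ _; simp
    | succ m ih =>
      intro i l hl hl'
      push_cast at hl' ⊢
      rw [← add_assoc i, hp (i + m) l hl (by omega), ← iter_one, iter_val, add_comm 1 l,
        ← ih i (l + 1) (by omega) (by omega), add_right_comm, add_assoc]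
  have hwin : ∀ i, Agree K (p i).1 (shift i fun j => (p j).1 0) := by
    intro i j hj hj'
    rw [shift_apply]
    rcases le_total 0 j with h0 | h0
    · have := hstep j.toNat i 0 (by omega) (by omega)
      rwa [Int.toNat_of_nonneg h0, zero_add] at this
    · have := hstep (-j).toNat (i + j) j hj (by omega)
      rw [Int.toNat_of_nonneg (by omega), add_neg_cancel, add_neg_cancel_right] at this
      exact this.symm
  exact ⟨⟨_, hN _ fun i => ⟨_, (p i).2, (hwin i).mono hK⟩⟩, fun i => (hwin i).symm⟩

end IrreducibleSFT

/-! ### Itinerary codes -/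

namespace IrreducibleSFT

variable (Y : IrreducibleSFT.{v}) {B : Type w}

/-- The itinerary of a point under a colouring `c`: the code with local rule `c`. -/
def itinerary (c : Y → B) (y : Y) : ℤ → B := fun i => c (Y.iter i y)

variable {Y} {c : Y → B}

theorem itinerary_iter (i : ℤ) (y : Y) : Y.itinerary c (Y.iter i y) = shift i (Y.itinerary c y) :=
  funext fun j => by rw [shift_apply, itinerary, itinerary, iter_iter, add_comm]

variable [TopologicalSpace B]

theorem continuous_itinerary (hc : Continuous c) : Continuous (Y.itinerary c) :=
  continuous_pi fun i => hc.comp (continuous_iter i)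

variable [DiscreteTopology B]

/-- The shift space of all itineraries. -/
def itineraryShift (hc : Continuous c) : Subshift B ℤ where
  carrier := Set.range (Y.itinerary c)
  isClosed := (isCompact_range (continuous_itinerary hc)).isClosed
  mapsTo := by
    rintro i _ ⟨y, rfl⟩
    exact ⟨Y.iter i y, itinerary_iter i y⟩

theorem isIrreducible_itineraryShift (hc : Continuous c) : IsIrreducible (itineraryShift hc) := by
  rw [isIrreducible_iff]
  rintro _ ⟨x, rfl⟩ _ ⟨y, rfl⟩ n m
  obtain ⟨z, hz, i, hi, hiz⟩ := exists_iter_mem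
    ((isOpen_setOf_agree n (Y.itinerary c x)).preimage (continuous_itinerary hc))
    ((isOpen_setOf_agree n (Y.itinerary c y)).preimage (continuous_itinerary hc))
    ⟨x, fun _ _ _ => rfl⟩ ⟨y, fun _ _ _ => rfl⟩ m
  exact ⟨_, ⟨z, rfl⟩, i, hi, hz, by rw [← itinerary_iter]; exact hiz⟩

end IrreducibleSFT

/-! ### Orbit spaces are shifts of finite type -/

namespace SlidingBlockCode

open IrreducibleSFT

variable {X : IrreducibleSFT.{u}} {Y : IrreducibleSFT.{v}} {ϖ : SlidingBlockCode Y X}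

/-- `g y` and `g z` agree on `[-K, K]` for every `g` in the Galois group. -/
def AgreeAll (ϖ : SlidingBlockCode Y X) (K : ℕ) (y z : Y) : Prop :=
  ∀ g : ϖ.Gal, Agree K (g.1.1 y).1 (g.1.1 z).1

theorem AgreeAll.map {K : ℕ} {y z : Y} (h : ϖ.AgreeAll K y z) (k : ϖ.Gal) :
    ϖ.AgreeAll K (k.1.1 y) (k.1.1 z) := fun g => h (g * k)

/-- Two points are related if, after moving one of them by an element of `H`, all their Galois
translates agree on `[-K, K]`. -/
def windowSetoid (H : Subgroup ϖ.Gal) (K : ℕ) : Setoid Y where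
  r y z := ∃ h ∈ H, ϖ.AgreeAll K z (h.1.1 y)
  iseqv :=
    { refl := fun _ => ⟨1, H.one_mem, fun _ _ _ _ => rfl⟩
      symm := by
        rintro y z ⟨h, hh, hyz⟩
        refine ⟨h⁻¹, H.inv_mem hh, fun g => ?_⟩
        have := (hyz.map h⁻¹ g).symm
        rwa [show (h⁻¹).1.1 (h.1.1 y) = y from h.1.1.symm_apply_apply y] at this
      trans := by
        rintro x y z ⟨h, hh, hxy⟩ ⟨k, hk, hyz⟩
        exact ⟨k * h, H.mul_mem hk hh, fun g => (hyz g).trans (hxy.map k g)⟩ }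

/-- The relation `windowSetoid` is the kernel of a colouring by a finite alphabet, in any
universe. -/
theorem IsGalois.exists_colouring (hϖ : ϖ.IsGalois) (H : Subgroup ϖ.Gal) (K : ℕ) :
    ∃ (n : ℕ) (c : Y → ULift.{w} (Fin n)),
      ∀ y z, c y = c z ↔ ∃ h ∈ H, ϖ.AgreeAll K z (h.1.1 y) := by
  have := hϖ.finite
  let E : Y → (ϖ.Gal → Finset.Icc (-K : ℤ) K → Y.Alphabet) := fun y g j => (g.1.1 y).1 j
  have hE : ∀ y z, E y = E z → ϖ.AgreeAll K y z := fun y z h g j h1 h2 =>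
    congrFun (congrFun h g) ⟨j, Finset.mem_Icc.2 ⟨h1, h2⟩⟩
  have hfin : Finite (Quotient (windowSetoid H K)) := by
    refine Finite.of_injective (fun q => E q.out) fun p q h => ?_
    rw [← p.out_eq, ← q.out_eq]
    exact Quotient.sound ⟨1, H.one_mem, hE _ _ h.symm⟩
  obtain ⟨n, ⟨e⟩⟩ := Finite.exists_equiv_fin (Quotient (windowSetoid H K))
  refine ⟨n, fun y => ⟨e (Quotient.mk _ y)⟩, fun y z => ?_⟩
  rw [ULift.up_inj, e.injective.eq_iff]
  exact Quotient.eq (r := windowSetoid H K)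

/-- For each subgroup `H` there is a shift of finite type factor of `Y` whose fibres are the
`H`-orbits: the itineraries of points with respect to the classes of `windowSetoid H K`, `K` large.
A sequence of classes with allowed transitions lifts to a pseudo-orbit of `Y`, which is shadowed;
two lifts of the same sequence differ by elements of `H` that are locally, hence globally,
constant. -/
theorem IsGalois.exists_orbit_code (hϖ : ϖ.IsGalois) (H : Subgroup ϖ.Gal) :
    ∃ (Z : IrreducibleSFT.{w}) (α : SlidingBlockCode Y Z), α.IsFactorMap ∧
      ∀ y z, α y = α z ↔ ∃ h ∈ H, z = h.1.1 y := by
  have := hϖ.finite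
  obtain ⟨M, hM⟩ := hϖ.2.elim fun _ hd => hd.1.exists_separated
  obtain ⟨N, hN⟩ := Y.exists_shadow
  choose r hr using fun g : ϖ.Gal => exists_window_map g.1.1.continuous g.1.2
  obtain ⟨R, hR⟩ := (Set.finite_range r).bddAbove
  -- `M + 1` makes overlapping windows separate fibres, `N` is for shadowing in `Y`, and `R` lets
  -- every `g` in the Galois group compute coordinate `0` of `g y` from the window of `y`.
  let K := M + 1 + N + R
  obtain ⟨n, c, hcK⟩ := hϖ.exists_colouring.{u, v, w} H K
  have hrR : ∀ g, r g ≤ R := fun g => hR ⟨g, rfl⟩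
  have hc : Continuous c := continuous_of_window (K + R) fun y z h =>
    (hcK y z).2 ⟨1, H.one_mem, fun g =>
      (hr g K y z (h.mono (Nat.add_le_add_left (hrR g) K))).symm⟩
  -- A sequence lifts as soon as its transitions do.
  have hlift : ∀ z : ℤ → ULift.{w} (Fin n),
      (∀ i, ∃ y, z i = c y ∧ z (i + 1) = c (Y.σ y)) → ∃ y, Y.itinerary c y = z := by
    intro z hz
    choose y hy hy' using hz
    have hk : ∀ i, ∃ k : H, ϖ.AgreeAll K (Y.σ (y i)) (k.1.1.1 (y (i + 1))) := fun i => by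
      obtain ⟨k, hk, h⟩ := (hcK (y (i + 1)) (Y.σ (y i))).1 (by rw [← hy, ← hy'])
      exact ⟨⟨k, hk⟩, h⟩
    choose k hk using hk
    obtain ⟨h, hh⟩ := exists_int_seq k
    let p : ℤ → Y := fun i => (h i).1.1.1 (y i)
    have hp : ∀ i, ϖ.AgreeAll K (p (i + 1)) (Y.σ (p i)) := by
      intro i g
      have := ((hk i).map (h i).1 g).symm
      rw [(h i).1.1.2 (y i)] at this
      simp only [p, hh]
      exact this
    have hshadow : ∀ g : ϖ.Gal, ∃ x : Y, ∀ i, Agree K (Y.iter i x).1 (g.1.1 (p i)).1 := fun g =>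
      hN K (by omega) (fun i => g.1.1 (p i)) fun i => by
        have := hp i g
        rwa [g.1.2 (p i)] at this
    choose x hx using hshadow
    -- The Galois translates of the shadowing point shadow the translates of the pseudo-orbit.
    have hgx : ∀ g : ϖ.Gal, x g = g.1.1 (x 1) := fun g => eq_of_forall_iter fun i => by
      rw [← map_iter g.1.2, hx g i 0 (by omega) (by omega)]
      exact (hr g 0 _ _ ((hx 1 i).mono (by have := hrR g; omega)) 0 (by simp) (by simp)).symm
    refine ⟨x 1, funext fun i => ?_⟩
    rw [hy i]
    refine (hcK _ _).2 ⟨(h i)⁻¹.1, (h i)⁻¹.2, fun g => ?_⟩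
    have h1 := hx (g * (h i)⁻¹.1) i
    rw [hgx, ← map_iter (g * (h i)⁻¹.1).1.2] at h1
    have h2 : (g * (h i)⁻¹.1).1.1 (p i) = g.1.1 (y i) :=
      congrArg g.1.1 ((h i).1.1.1.symm_apply_apply (y i))
    rw [h2] at h1
    exact h1.symm
  -- The windows of radius `K` at `i` and `i + 1` overlap in one that still separates fibres, so the
  -- group element relating `y` to `z` at time `i` does not depend on `i`.
  have hfib : ∀ y z, Y.itinerary c y = Y.itinerary c z ↔ ∃ h ∈ H, z = h.1.1 y := by
    intro y z
    constructor
    · intro hyz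
      have hex : ∀ i, ∃ h ∈ H, ϖ.AgreeAll K (Y.iter i z) (h.1.1 (Y.iter i y)) := fun i =>
        (hcK _ _).1 (congrFun hyz i)
      choose h hH hh using hex
      have hag : ∀ i, Agree K (Y.iter i z).1 ((h i).1.1 (Y.iter i y)).1 := fun i => hh i 1
      have hsucc : ∀ i, h (i + 1) = h i := by
        intro i
        refine hϖ.relAut_ext (y := Y.iter (i + 1) y) (hM _ _ ?_ ?_)
        · rw [(h (i + 1)).2, (h i).2]
        · refine ((hag (i + 1)).symm.mono (by omega)).trans fun j hj hj' => ?_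
          have := hag i (j + 1) (by omega) (by omega)
          rw [map_iter (h i).1.2, iter_val, iter_val] at this ⊢
          convert this using 2 <;> omega
      have hall : ∀ i, h i = h 0 := fun i => by
        induction i using Int.induction_on with
        | zero => rfl
        | succ i ih => rw [hsucc, ih]
        | pred i ih => rw [← ih, ← hsucc, sub_add_cancel]
      refine ⟨h 0, hH 0, eq_of_forall_iter fun i => ?_⟩
      rw [← map_iter (h 0).1.2, ← hall i]
      exact hag i 0 (by omega) (by omega)
    · rintro ⟨h, hh, rfl⟩
      refine funext fun i => (hcK _ _).2 ⟨h, hh, fun g j _ _ => ?_⟩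
      rw [map_iter h.1.2]
  have hsft : IsSFT (itineraryShift hc) := isSFT_iff.2 ⟨1, fun z hz => hlift z fun i => by
    obtain ⟨_, ⟨y, rfl⟩, hy⟩ := hz i
    refine ⟨y, ?_, ?_⟩
    · have := hy 0 (by simp) (by simp)
      rw [shift_apply, add_zero, itinerary, iter_zero] at this
      exact this.symm
    · have := hy 1 (by simp) (by simp)
      rw [shift_apply, itinerary, iter_one] at this
      exact this.symm⟩
  obtain ⟨y₀, hy₀⟩ := Y.nonempty
  exact ⟨⟨ULift.{w} (Fin n), itineraryShift hc, ⟨_, ⟨y₀, hy₀⟩, rfl⟩, hsft,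
    isIrreducible_itineraryShift hc⟩, ⟨fun y => ⟨Y.itinerary c y, y, rfl⟩,
    (continuous_itinerary hc).subtype_mk _, fun y => Subtype.ext (itinerary_iter 1 y)⟩,
    fun ⟨_, y, hy⟩ => ⟨y, Subtype.ext hy⟩, fun y z => Subtype.ext_iff.trans (hfib y z)⟩

end SlidingBlockCode

/-- The orbit factor of any subgroup of the Galois group exists. -/
theorem IntermediateFactor.exists_isOrbitFactor {X : IrreducibleSFT.{u}} {Y : IrreducibleSFT.{v}}
    {ϖ : SlidingBlockCode Y X} (hϖ : ϖ.IsGalois) (H : Subgroup ϖ.Gal) :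
    ∃ F : IntermediateFactor.{u, v, w} ϖ, F.IsOrbitFactor H := by
  obtain ⟨Z, α, hα, hfib⟩ := hϖ.exists_orbit_code.{u, v, w} H
  have hq : Topology.IsQuotientMap α :=
    α.continuous.isClosedMap.isQuotientMap α.continuous hα
  have hβ : ∀ y, ϖ (Function.surjInv hα (α y)) = ϖ y := fun y => by
    obtain ⟨h, -, hy⟩ := (hfib _ _).1 (Function.surjInv_eq hα (α y))
    exact (h.2 _).symm.trans (congrArg ϖ.toFun hy.symm)
  let β : SlidingBlockCode Z X :=
    { toFun := fun z => ϖ (Function.surjInv hα z)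
      continuous := hq.continuous_iff.2 (ϖ.continuous.congr fun y => (hβ y).symm)
      map_shift := fun z => by
        obtain ⟨y, rfl⟩ := hα z
        rw [← α.map_shift, hβ, hβ, ϖ.map_shift] }
  exact ⟨⟨Z, α, β, ⟨hα, _, hϖ.hasDegree_of_orbits hα hfib⟩, hβ⟩,
    IntermediateFactor.isOrbitFactor_iff.2 hfib⟩

end ShiftGalois

/-- The fundamental theorem of Galois theory for shifts of finite type. The first clause says that
`Ψ H` is the class of the orbit-space factor `Y/H`; in particular `Y/H` is topologically conjugate
to an irreducible SFT. -/
theorem theorem1p1 (X : ShiftGalois.IrreducibleSFT.{u}) (Y : ShiftGalois.IrreducibleSFT.{v})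
    (ϖ : ShiftGalois.SlidingBlockCode Y X) (hϖ : ϖ.IsGalois) :
    ∃ Ψ : Subgroup ϖ.Gal → ShiftGalois.ConjClass.{u, v, w} ϖ,
      (∀ (H : Subgroup ϖ.Gal) (F : ShiftGalois.IntermediateFactor.{u, v, w} ϖ),
        Ψ H = Quotient.mk _ F ↔ F.IsOrbitFactor H) ∧
      (∀ (H : Subgroup ϖ.Gal) (F : ShiftGalois.IntermediateFactor.{u, v, w} ϖ),
        Ψ H = Quotient.mk _ F → F.α.IsGalois) ∧
      (∀ H : Subgroup ϖ.Gal, (Ψ H).Φ = H) ∧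
      (∀ c : ShiftGalois.ConjClass.{u, v, w} ϖ, Ψ c.Φ = c) := by
  choose F hF using ShiftGalois.IntermediateFactor.exists_isOrbitFactor.{u, v, w} hϖ
  have key : ∀ H F', (Quotient.mk _ (F H) : ShiftGalois.ConjClass.{u, v, w} ϖ) = Quotient.mk _ F' ↔
      F'.IsOrbitFactor H := fun H F' =>
    ⟨fun h => (hF H).of_conj (Quotient.exact h), fun h => Quotient.sound ((hF H).conj h)⟩
  refine ⟨fun H => Quotient.mk _ (F H), key, fun H F' h => ((key H F').1 h).isGalois hϖ,
    fun H => (hF H).H_eq hϖ, ?_⟩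
  rintro ⟨F'⟩
  exact (key _ F').2 (ShiftGalois.IntermediateFactor.isOrbitFactor_H hϖ F')
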